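/- Let $\mathbb{K}$ be a field, let $\mathrm{Vect}$ be the monoidal category of $\mathbb{K}$-vector spaces, and let $\mathrm{Pic}(\mathrm{Vect})$ be its Picard groupoid (lines and their isomorphisms). Let $G$ be an $\infty$-group, with delooping $BG$ (an $\infty$-groupoid with one object) and discrete group $\pi_0(G)$ of isomorphism classes of objects. Let $\rho$ be a 2-character on $G$, i.e. an $\infty$-functor $BG\to B\,\mathrm{Pic}(\mathrm{Vect})$; it consists of lines $W_g$ for the objects $g$ of $G$, isomorphisms $\psi\colon W_g\otimes W_h\to W_k$ for the 2-simplices of $BG$ exhibiting $k$ as $gh$, and a unit isomorphism $W_1\cong\mathbb{K}$, coherently. Let $V$ be a homotopy fixed point of $\rho$, i.e. a morphism $\underline{1}\to W$ from the trivial $\infty$-functor to the $\infty$-functor $W\colon BG\to 2\text{-}\mathrm{Vect}$ defined by $\rho$ through the action of $\mathrm{Pic}(\mathrm{Vect})$ on $\mathrm{Vect}$; it consists of a vector space $V$ and isomorphisms $\varphi_g\colon W_g\otimes V\to V$ compatible with the isomorphisms $\psi$ and the unit. Assume $V\neq 0$. For a 2-cocycle $\alpha\colon \pi_0(G)\times\pi_0(G)\to\mathbb{K}^*$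 let $T(\alpha)$ be the 2-character on $G$ with all lines equal to $\mathbb{K}$ and with $\psi$ equal to $\mathbb{K}\otimes\mathbb{K}\cong\mathbb{K}$ followed by multiplication by $\alpha([g],[h])$ (and unit isomorphism $\alpha(1,1)$). A projective representation of $\pi_0(G)$ with 2-cocycle $\alpha$ is a vector space $U$ with automorphisms $\varphi_a$, $a\in\pi_0(G)$, such that $\varphi_a\circ\varphi_b=\alpha(a,b)\,\varphi_{ab}$; its realization is the homotopy fixed point of $T(\alpha)$ given by $U$ and $W_g\otimes U=\mathbb{K}\otimes U\cong U\xrightarrow{\varphi_{[g]}}U$. Then there is a 2-cocycle $\alpha_\rho$ on $\pi_0(G)$ with values in $\mathbb{K}^*$, unique up to equivalence (that is, up to coboundaries), such that $V$ is isomorphic to the realization of a projective representation of $\pi_0(G)$ with 2-cocycle $\alpha_\rho$. Here the isomorphism consists of an isomorphism $T(\alpha_\rho)\cong\rho$ of 2-characters on $G$, i.e. isomorphisms $\xi_g\colon\mathbb{K}\to W_g$ compatible with the $\psi$ and the units, and an isomorphism of vector spaces $f\colon U\to V$ such that $\varphi^{V}_g\circ(\xi_g\otimes f)=f\circ\varphi^{U}_g$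 for all objects $g$ of $G$, where $\varphi^{U}$ and $\varphi^{V}$ are the structure isomorphisms of the realization and of $V$. -/

import Mathlib

open CategoryTheory Simplicial
universe w v u

namespace AnomalousTQFT

/-- Horn filling in a Kan complex, in terms of simplices. -/
theorem exists_filler {X : SSet.{w}} [SSet.KanComplex X] {n : ℕ} (i : Fin (n + 3))
    (s : Fin (n + 3) → X _⦋n + 1⦌)
    (hs : ∀ (j k : Fin (n + 3)) (_ : j ≠ i) (_ : k ≠ i) (hjk : j < k),
      X.δ (k.pred (Fin.ne_zero_of_lt hjk)) (s j) =
        X.δ (j.castPred (Fin.ne_last_of_lt hjk)) (s k)) :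
    ∃ t : X _⦋n + 2⦌, ∀ j, j ≠ i → X.δ j t = s j := by
  have hc : SSet.horn.IsCompatible (i := i)
      (fun j (_ : j ≠ i) => SSet.yonedaEquiv.symm (s j)) := by
    rw [SSet.horn.isCompatible_iff]
    intro j k hj hk hjk
    rw [SSet.stdSimplex.δ_comp_yonedaEquiv_symm, SSet.stdSimplex.δ_comp_yonedaEquiv_symm,
      hs j k hj hk hjk]
  obtain ⟨φ, hφ⟩ := hc.exists_lift_of_kanComplex
  refine ⟨SSet.yonedaEquiv φ, fun j hj => ?_⟩
  rw [← SSet.stdSimplex.yonedaEquiv_δ_comp, hφ j hj, Equiv.apply_symm_apply]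

/-- The `2`-truncation of a Kan complex has the low-dimensional inner horn fillers, so that homotopy
classes of its edges form a category. -/
instance quasicategory₂ (X : SSet.{w}) [SSet.KanComplex X] :
    SSet.Truncated.Quasicategory₂ ((SSet.truncation 2).obj X) where
  fill21 {x₀ x₁ x₂} e₀₁ e₁₂ := by
    obtain ⟨t, ht⟩ := exists_filler (X := X) (n := 0) 1 ![e₁₂.edge, e₁₂.edge, e₀₁.edge] (by
      intro j k hj hk hjk
      fin_cases j <;> fin_cases k <;> simp at hj hk hjk
      exact e₁₂.src_eq.trans e₀₁.tgt_eq.symm)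
    have h0 : X.δ 0 t = e₁₂.edge := ht 0 (by decide)
    have h2 : X.δ 2 t = e₀₁.edge := ht 2 (by decide)
    refine ⟨⟨⟨X.δ 1 t, ?_, ?_⟩, ⟨t, h2, h0, rfl⟩⟩⟩
    · refine Eq.trans ?_ e₀₁.src_eq
      change X.δ 1 (X.δ 1 t) = X.δ 1 e₀₁.edge
      rw [← h2]
      exact SSet.δ_comp_δ_self_apply (i := 1) t
    · refine Eq.trans ?_ e₁₂.tgt_eq
      change X.δ 0 (X.δ 1 t) = X.δ 0 e₁₂.edge
      rw [← h0]
      exact (SSet.δ_comp_δ_self_apply (i := 0) t).symm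
  fill31 {x₀ x₁ x₂ x₃} _ _ _ _ _ _ f₃ f₀ f₂ := by
    obtain ⟨t, ht⟩ := exists_filler (X := X) (n := 1) 1
      ![f₀.simplex, f₀.simplex, f₂.simplex, f₃.simplex] (by
      intro j k hj hk hjk
      fin_cases j <;> fin_cases k <;> simp at hj hk hjk
      · exact f₀.d₁.trans f₂.d₀.symm
      · exact f₀.d₂.trans f₃.d₀.symm
      · exact f₂.d₂.trans f₃.d₂.symm)
    have h0 : X.δ 0 t = f₀.simplex := ht 0 (by decide)
    have h2 : X.δ 2 t = f₂.simplex := ht 2 (by decide)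
    have h3 : X.δ 3 t = f₃.simplex := ht 3 (by decide)
    refine ⟨⟨X.δ 1 t, ?_, ?_, ?_⟩⟩
    · refine Eq.trans ?_ f₃.d₁
      change X.δ 2 (X.δ 1 t) = X.δ 1 f₃.simplex
      rw [← h3]
      exact (SSet.δ_comp_δ_apply (i := 1) (j := 2) (by decide) t).symm
    · refine Eq.trans ?_ f₀.d₀
      change X.δ 0 (X.δ 1 t) = X.δ 0 f₀.simplex
      rw [← h0]
      exact (SSet.δ_comp_δ_self_apply (i := 0) t).symm
    · refine Eq.trans ?_ f₂.d₁
      change X.δ 1 (X.δ 1 t) = X.δ 1 f₂.simplex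
      rw [← h2]
      exact SSet.δ_comp_δ_self_apply (i := 1) t
  fill32 {x₀ x₁ x₂ x₃} _ _ _ _ _ _ f₃ f₀ f₁ := by
    obtain ⟨t, ht⟩ := exists_filler (X := X) (n := 1) 2
      ![f₀.simplex, f₁.simplex, f₀.simplex, f₃.simplex] (by
      intro j k hj hk hjk
      fin_cases j <;> fin_cases k <;> simp at hj hk hjk
      · exact f₀.d₀.trans f₁.d₀.symm
      · exact f₀.d₂.trans f₃.d₀.symm
      · exact f₁.d₂.trans f₃.d₁.symm)
    have h0 : X.δ 0 t = f₀.simplex := ht 0 (by decide)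
    have h1 : X.δ 1 t = f₁.simplex := ht 1 (by decide)
    have h3 : X.δ 3 t = f₃.simplex := ht 3 (by decide)
    refine ⟨⟨X.δ 2 t, ?_, ?_, ?_⟩⟩
    · refine Eq.trans ?_ f₃.d₂
      change X.δ 2 (X.δ 2 t) = X.δ 2 f₃.simplex
      rw [← h3]
      exact SSet.δ_comp_δ_self_apply (i := 2) t
    · refine Eq.trans ?_ f₀.d₁
      change X.δ 0 (X.δ 2 t) = X.δ 1 f₀.simplex
      rw [← h0]
      exact SSet.δ_comp_δ_apply (i := 0) (j := 1) (by decide) t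
    · refine Eq.trans ?_ f₁.d₁
      change X.δ 1 (X.δ 2 t) = X.δ 1 f₁.simplex
      rw [← h1]
      exact (SSet.δ_comp_δ_self_apply (i := 1) t).symm

/-- An `∞`-group `G`, given through its delooping `BG`: an `∞`-groupoid (Kan complex) with exactly one
object. The objects of `G` are the edges of `BG`, a `1`-morphism `g ⟶ h` of `G` is a `2`-simplex of
`BG` from `g` to `h` (its remaining edge is degenerate), and so on. A `2`-simplex with first edge `h`,
second edge `g` and long edge `k` exhibits `k` as the product `gh`. -/
structure InftyGroup where
  B : SSet.{w}
  [kan : SSet.KanComplex B]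
  [unique : Unique (B _⦋0⦌)]

namespace InftyGroup
attribute [instance] kan unique
variable (G : InftyGroup.{w})

/-- The unique object of `BG`. -/
def pt : G.B _⦋0⦌ := default

/-- The objects of the `∞`-group `G`: the loops at the unique object of `BG`. -/
abbrev Obj : Type w := SSet.Edge G.pt G.pt

/-- The set `π₀(G)` of isomorphism classes of objects of `G`, that is, of homotopy classes of loops in
`BG`, where `g` and `h` are identified if there is a `2`-simplex with edges `g`, `id`, `h` (see
`InftyGroup.cls_eq_iff`). Its product is that of endomorphisms, in the order of composition of
functions: `cls g * cls h = cls k` for every `2`-simplex with first edge `h`, second edge `g` and long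
edge `k` (see `InftyGroup.cls_mul`). -/
def PiZero : Type w :=
  End (SSet.Truncated.HomotopyCategory₂.mk (A := (SSet.truncation 2).obj G.B) G.pt)

variable {G}

/-- The class in `π₀(G)` of an object of `G`, that is, the projection `BG ⟶ Bπ₀(G)` on edges. (All
vertices of `BG` are equal, so that every edge is an object of `G`.) -/
def cls {x y : G.B _⦋0⦌} (e : SSet.Edge x y) : G.PiZero :=
  SSet.Truncated.HomotopyCategory₂.homMk
    (e.ofEq (Subsingleton.elim x G.pt) (Subsingleton.elim y G.pt)).toTruncated

noncomputable instance : Monoid G.PiZero := inferInstanceAs (Monoid (End _))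

theorem cls_id (x : G.B _⦋0⦌) : cls (SSet.Edge.id x) = 1 := by
  obtain rfl := Subsingleton.elim x G.pt
  rfl

theorem cls_mul {x y z : G.B _⦋0⦌} {e : SSet.Edge x y} {f : SSet.Edge y z} {g : SSet.Edge x z}
    (σ : SSet.Edge.CompStruct e f g) : cls f * cls e = cls g := by
  obtain rfl := Subsingleton.elim x G.pt
  obtain rfl := Subsingleton.elim y G.pt
  obtain rfl := Subsingleton.elim z G.pt
  exact σ.toTruncated.homotopyCategory₂_fac

theorem cls_surjective (a : G.PiZero) : ∃ e : G.Obj, cls e = a := by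
  obtain ⟨e, he⟩ := SSet.Truncated.HomotopyCategory₂.homMk_surjective a
  exact ⟨e, he⟩

theorem cls_eq_iff (g h : G.Obj) :
    cls g = cls h ↔ Nonempty (SSet.Edge.CompStruct g (SSet.Edge.id G.pt) h) :=
  ⟨fun H => Quotient.exact H, fun H => Quotient.sound H⟩

theorem exists_left_inv (a : G.PiZero) : ∃ b : G.PiZero, b * a = 1 := by
  obtain ⟨e, rfl⟩ := cls_surjective a
  obtain ⟨t, ht⟩ := exists_filler (X := G.B) (n := 0) 0
    ![e.edge, (SSet.Edge.id G.pt).edge, e.edge] (by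
    intro j k hj hk hjk
    fin_cases j <;> fin_cases k <;> simp at hj hk hjk
    exact (SSet.Edge.id G.pt).src_eq.trans e.src_eq.symm)
  have h1 : G.B.δ 1 t = (SSet.Edge.id G.pt).edge := ht 1 (by decide)
  have h2 : G.B.δ 2 t = e.edge := ht 2 (by decide)
  let f : G.Obj := SSet.Edge.mk (G.B.δ 0 t) (Subsingleton.elim _ _) (Subsingleton.elim _ _)
  refine ⟨cls f, ?_⟩
  rw [cls_mul (SSet.Edge.CompStruct.mk t h2 rfl h1 : SSet.Edge.CompStruct e f _), cls_id]

noncomputable instance : Group G.PiZero :=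
  { (inferInstance : Monoid G.PiZero) with
    inv := fun a => (exists_left_inv a).choose
    inv_mul_cancel := fun a => (exists_left_inv a).choose_spec }

end InftyGroup

section Deloop
open MonoidalCategory
/-- The delooping `BC` of a monoidal category `C`: the bicategory with one object whose category of
`1`-morphisms is `C`, where "first `X`, then `Y`" is `Y ⊗ X`, as for the composition of the functors
`Y ⊗ -` and `X ⊗ -`. -/
def Deloop (C : Type u) [Category.{v} C] [MonoidalCategory C] : Type := Unit

instance (C : Type u) [Category.{v} C] [MonoidalCategory C] : Bicategory (Deloop C) where
  Hom _ _ := C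
  id _ := 𝟙_ C
  comp X Y := Y ⊗ X
  whiskerLeft X _ _ f := f ▷ X
  whiskerRight f Z := Z ◁ f
  associator X Y Z := (α_ Z Y X).symm
  leftUnitor X := ρ_ X
  rightUnitor X := λ_ X
  whisker_exchange f g := (whisker_exchange g f).symm

/-- The unique object of `BC`. -/
def Deloop.star (C : Type u) [Category.{v} C] [MonoidalCategory C] : Deloop C := Unit.unit

end Deloop

section Coherent
open Bicategory

/-- A (homotopy coherent) `∞`-functor from a simplicial set `X` to a bicategory `B`, only the
invertible `2`-cells of `B` being used. It assigns objects to vertices, `1`-morphisms to edges, invertible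
`2`-cells to `2`-simplices, subject to an equation for each `3`-simplex; as `B` has only identity
`k`-morphisms for `k > 2`, simplices of higher dimension carry neither data nor conditions. This is
the usual description of a simplicial map from `X` to the Duskin nerve of the bicategory of invertible
`2`-cells in `B`, except that degenerate edges are sent to identities only up to the coherent
isomorphism `mapId` (so that strictly unital functors are the case where `mapId` is an identity). -/
structure InftyFunctor (X : SSet.{w}) (B : Type*) [Bicategory B] where
  obj : X _⦋0⦌ → B
  map {x y : X _⦋0⦌} : SSet.Edge x y → (obj x ⟶ obj y)
  mapId (x : X _⦋0⦌) : map (SSet.Edge.id x) ≅ 𝟙 (obj x)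
  mapComp {x y z : X _⦋0⦌} {e : SSet.Edge x y} {f : SSet.Edge y z} {g : SSet.Edge x z} :
    SSet.Edge.CompStruct e f g → (map e ≫ map f ≅ map g)
  id_comp {x y : X _⦋0⦌} (e : SSet.Edge x y) :
    (mapComp (SSet.Edge.CompStruct.idComp e)).hom = (mapId x).hom ▷ map e ≫ (λ_ (map e)).hom
  comp_id {x y : X _⦋0⦌} (e : SSet.Edge x y) :
    (mapComp (SSet.Edge.CompStruct.compId e)).hom = map e ◁ (mapId y).hom ≫ (ρ_ (map e)).hom
  assoc {x₀ x₁ x₂ x₃ : X _⦋0⦌} {e₀₁ : SSet.Edge x₀ x₁} {e₁₂ : SSet.Edge x₁ x₂}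
    {e₂₃ : SSet.Edge x₂ x₃} {e₀₂ : SSet.Edge x₀ x₂} {e₁₃ : SSet.Edge x₁ x₃} {e₀₃ : SSet.Edge x₀ x₃}
    (σ₀ : SSet.Edge.CompStruct e₁₂ e₂₃ e₁₃) (σ₁ : SSet.Edge.CompStruct e₀₂ e₂₃ e₀₃)
    (σ₂ : SSet.Edge.CompStruct e₀₁ e₁₃ e₀₃) (σ₃ : SSet.Edge.CompStruct e₀₁ e₁₂ e₀₂)
    (τ : X _⦋3⦌) : X.δ 0 τ = σ₀.simplex → X.δ 1 τ = σ₁.simplex → X.δ 2 τ = σ₂.simplex →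
      X.δ 3 τ = σ₃.simplex →
    (mapComp σ₃).hom ▷ map e₂₃ ≫ (mapComp σ₁).hom =
      (α_ (map e₀₁) (map e₁₂) (map e₂₃)).hom ≫ map e₀₁ ◁ (mapComp σ₀).hom ≫ (mapComp σ₂).hom

/-- The trivial `∞`-functor, sending all vertices to `b` and all edges to the identity of `b`. -/
def InftyFunctor.const (X : SSet.{w}) {B : Type*} [Bicategory B] (b : B) : InftyFunctor X B where
  obj _ := b
  map _ := 𝟙 b
  mapId _ := Iso.refl _
  mapComp _ := λ_ (𝟙 b)
  id_comp _ := by simp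
  comp_id _ := by simp [unitors_equal]
  assoc _ _ _ _ _ _ _ _ _ := by simp [unitors_equal]

/-- A morphism of `∞`-functors `F ⟶ F'` with values in a bicategory: a pseudonatural transformation,
with a `1`-morphism for each vertex, an invertible `2`-cell for each edge, and an equation for each
`2`-simplex, together with compatibility with the units. -/
structure InftyTrans {X : SSet.{w}} {B : Type*} [Bicategory B] (F F' : InftyFunctor X B) where
  app (x : X _⦋0⦌) : F.obj x ⟶ F'.obj x
  naturality {x y : X _⦋0⦌} (e : SSet.Edge x y) : app x ≫ F'.map e ≅ F.map e ≫ app y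
  naturality_id (x : X _⦋0⦌) :
    app x ◁ (F'.mapId x).hom ≫ (ρ_ (app x)).hom =
      (naturality (SSet.Edge.id x)).hom ≫ (F.mapId x).hom ▷ app x ≫ (λ_ (app x)).hom
  naturality_comp {x y z : X _⦋0⦌} {e : SSet.Edge x y} {f : SSet.Edge y z} {g : SSet.Edge x z}
    (σ : SSet.Edge.CompStruct e f g) :
    app x ◁ (F'.mapComp σ).hom ≫ (naturality g).hom =
      (α_ (app x) (F'.map e) (F'.map f)).inv ≫ (naturality e).hom ▷ F'.map f ≫
        (α_ (F.map e) (app y) (F'.map f)).hom ≫ F.map e ◁ (naturality f).hom ≫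
        (α_ (F.map e) (F.map f) (app z)).inv ≫ (F.mapComp σ).hom ▷ app z

end Coherent

section Vect
open MonoidalCategory
variable (K : Type u) [Field K]

/-- The category of `K`-vector spaces. -/
abbrev Vect : Type (u + 1) := ModuleCat.{u} K

/-- The objects of `Vect` that are invertible for the tensor product, i.e. the lines. -/
def isInvertible : ObjectProperty (Vect K) :=
  fun W => ∃ W' : Vect K, Nonempty (W ⊗ W' ≅ 𝟙_ (Vect K))

instance : (isInvertible K).IsMonoidal where
  prop_unit := ⟨𝟙_ _, ⟨λ_ _⟩⟩
  prop_tensor := by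
    rintro W₁ W₂ ⟨W₁', ⟨i₁⟩⟩ ⟨W₂', ⟨i₂⟩⟩
    exact ⟨W₂' ⊗ W₁', ⟨α_ W₁ W₂ (W₂' ⊗ W₁') ≪≫
      whiskerLeftIso W₁ ((α_ W₂ W₂' W₁').symm ≪≫ whiskerRightIso i₂ W₁' ≪≫ λ_ W₁') ≪≫ i₁⟩⟩

/-- The Picard category of `Vect`: the full monoidal subcategory of invertible objects. (Its groupoid
of isomorphisms is what `∞`-functors into its delooping see, for they involve only invertible
`2`-cells.) -/
abbrev Pic : Type (u + 1) := (isInvertible K).FullSubcategory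

section Scalar
variable {K} {C : Type*} [Category* C] [Preadditive C] [Linear K C]

/-- Multiplication by a nonzero scalar, as an automorphism. -/
@[simps]
def scalarIso (c : Kˣ) (X : C) : X ≅ X where
  hom := (c : K) • 𝟙 X
  inv := ((c⁻¹ : Kˣ) : K) • 𝟙 X
  hom_inv_id := by simp [smul_smul]
  inv_hom_id := by simp [smul_smul]

end Scalar

section ScalarLemmas

theorem scalar_comp_id {K : Type u} [Field K] {C : Type*} [Category* C] [MonoidalCategory C]
    [Preadditive C] [Linear K C] (c : K) :
    (λ_ (𝟙_ C)).hom ≫ (c • 𝟙 (𝟙_ C)) = ((c • 𝟙 (𝟙_ C)) ▷ 𝟙_ C) ≫ (λ_ (𝟙_ C)).hom := by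
  simp

variable {K} {C : Type*} [Category* C] [MonoidalCategory C] [Preadditive C] [MonoidalPreadditive C]
  [Linear K C] [MonoidalLinear K C]

theorem scalar_id_comp (c : K) :
    (λ_ (𝟙_ C)).hom ≫ (c • 𝟙 (𝟙_ C)) = (𝟙_ C ◁ (c • 𝟙 (𝟙_ C))) ≫ (ρ_ (𝟙_ C)).hom := by
  simp [MonoidalCategory.unitors_equal]

theorem scalar_assoc (c₀ c₁ c₂ c₃ : K) (h : c₂ * c₀ = c₁ * c₃) :
    (𝟙_ C ◁ ((λ_ (𝟙_ C)).hom ≫ (c₃ • 𝟙 (𝟙_ C)))) ≫ (λ_ (𝟙_ C)).hom ≫ (c₁ • 𝟙 (𝟙_ C)) =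
      (α_ (𝟙_ C) (𝟙_ C) (𝟙_ C)).inv ≫ (((λ_ (𝟙_ C)).hom ≫ (c₀ • 𝟙 (𝟙_ C))) ▷ 𝟙_ C) ≫
        (λ_ (𝟙_ C)).hom ≫ (c₂ • 𝟙 (𝟙_ C)) := by
  simp [smul_smul, h, MonoidalCategory.unitors_equal]

end ScalarLemmas

/-- A `2`-character on the `∞`-group `G`: an `∞`-functor `BG ⟶ B Pic(Vect)`. -/
abbrev TwoCharacter (G : InftyGroup.{w}) : Type (max w (u + 1)) :=
  InftyFunctor G.B (Deloop (Pic K))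

variable {K} {G : InftyGroup.{w}}

/-- The `∞`-functor `W : BG ⟶ 2-Vect` defined by a `2`-character. It sends the object of `BG` to the
unit object `Vect` of `2-Vect`, so it takes values in the full sub-`2`-category of `2-Vect` on that
object. As the endomorphisms of the unit object in `2-Vect` are the functors `V ⊗ -`, i.e. form the
monoidal category `Vect`, this sub-`2`-category is `B Vect`. -/
def TwoCharacter.toVect (ρ : TwoCharacter K G) : InftyFunctor G.B (Deloop (Vect K)) where
  obj _ := Deloop.star (Vect K)
  map e := (isInvertible K).ι.obj (ρ.map e)
  mapId x := (isInvertible K).ι.mapIso (ρ.mapId x)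
  mapComp σ := (isInvertible K).ι.mapIso (ρ.mapComp σ)
  id_comp e := congrArg (fun f => f.hom) (ρ.id_comp e)
  comp_id e := congrArg (fun f => f.hom) (ρ.comp_id e)
  assoc σ₀ σ₁ σ₂ σ₃ τ h₀ h₁ h₂ h₃ :=
    congrArg (fun f => f.hom) (ρ.assoc σ₀ σ₁ σ₂ σ₃ τ h₀ h₁ h₂ h₃)

/-- The line `W_g` of a `2`-character. -/
def TwoCharacter.line (ρ : TwoCharacter K G) (g : G.Obj) : Vect K := ρ.toVect.map g

/-- The isomorphism `ψ : W_g ⊗ W_h ≅ W_k` given by a `2`-simplex exhibiting `k` as the product `gh`. -/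
def TwoCharacter.psi (ρ : TwoCharacter K G) {g h k : G.Obj} (σ : SSet.Edge.CompStruct h g k) :
   ρ.line g ⊗ ρ.line h ≅ ρ.line k := ρ.toVect.mapComp σ

/-- The unit isomorphism `W_1 ≅ K` of a `2`-character. -/
def TwoCharacter.unit (ρ : TwoCharacter K G) : ρ.line (SSet.Edge.id G.pt) ≅ 𝟙_ (Vect K) :=
  ρ.toVect.mapId G.pt

/-- An isomorphism of `2`-characters: isomorphisms of lines `ξ_g : W_g ≅ W'_g` for the objects `g` of
`G`, compatible with the unit and with all `2`-simplices of `BG`. -/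
structure TwoCharacter.Equivalence (ρ ρ' : TwoCharacter K G) where
  xi (g : G.Obj) : ρ.line g ≅ ρ'.line g
  xi_unit : (xi (SSet.Edge.id G.pt)).hom ≫ ρ'.unit.hom = ρ.unit.hom
  xi_comp {g h k : G.Obj} (σ : SSet.Edge.CompStruct h g k) :
    ((xi g).hom ⊗ₘ (xi h).hom) ≫ (ρ'.psi σ).hom = (ρ.psi σ).hom ≫ (xi k).hom

/-- A homotopy fixed point of the `2`-character `ρ`: a morphism of `∞`-functors `1 ⟶ W`, where `1` is
the trivial `∞`-functor `BG ⟶ 2-Vect` and `W` is the one defined by `ρ`. -/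
abbrev HomotopyFixedPoint (ρ : TwoCharacter K G) : Type (max w (u + 1)) :=
  InftyTrans (InftyFunctor.const G.B (Deloop.star (Vect K))) ρ.toVect

/-- The underlying vector space `V` of a homotopy fixed point. -/
def HomotopyFixedPoint.space {ρ : TwoCharacter K G} (V : HomotopyFixedPoint ρ) : Vect K :=
  V.app G.pt

/-- The isomorphisms `φ_g : W_g ⊗ V ≅ V` of a homotopy fixed point. -/
def HomotopyFixedPoint.phi {ρ : TwoCharacter K G} (V : HomotopyFixedPoint ρ) (g : G.Obj) :
    ρ.line g ⊗ V.space ≅ V.space :=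
  V.naturality g ≪≫ ρ_ V.space

/-- An isomorphism between homotopy fixed points of two `2`-characters `ρ`, `ρ'` that are identified by
`ξ`: an isomorphism of vector spaces `V ≅ V'` which commutes with all `φ_g`. -/
structure HomotopyFixedPoint.IsoOver {ρ ρ' : TwoCharacter K G} (ξ : ρ.Equivalence ρ')
    (V : HomotopyFixedPoint ρ) (V' : HomotopyFixedPoint ρ') where
  iso : V.space ≅ V'.space
  comm (g : G.Obj) : ((ξ.xi g).hom ⊗ₘ iso.hom) ≫ (V'.phi g).hom = (V.phi g).hom ≫ iso.hom

variable (K) in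
/-- A `2`-cocycle on a (discrete) group with values in `Kˣ` (trivial action). -/
structure TwoCocycle (Γ : Type w) [Group Γ] where
  toFun : Γ → Γ → Kˣ
  cocycle (a b c : Γ) : toFun (a * b) c * toFun a b = toFun a (b * c) * toFun b c

/-- Equivalence of `2`-cocycles: they differ by a coboundary. -/
def TwoCocycle.Equivalent {Γ : Type w} [Group Γ] (α α' : TwoCocycle K Γ) : Prop :=
  ∃ β : Γ → Kˣ, ∀ a b, α'.toFun a b * β (a * b) = α.toFun a b * β a * β b

theorem TwoCocycle.one_left {Γ : Type w} [Group Γ] (α : TwoCocycle K Γ) (a : Γ) :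
    α.toFun 1 a = α.toFun 1 1 := by
  have h := α.cocycle 1 1 a
  simp only [mul_one, one_mul] at h
  exact (mul_left_cancel h).symm

theorem TwoCocycle.one_right {Γ : Type w} [Group Γ] (α : TwoCocycle K Γ) (a : Γ) :
    α.toFun a 1 = α.toFun 1 1 := by
  have h := α.cocycle a 1 1
  simp only [mul_one] at h
  exact mul_left_cancel h

/-- A projective representation of a group with `2`-cocycle `α`: a vector space with automorphisms `φ_a`
such that `φ_a ∘ φ_b = α(a,b) φ_{ab}`. -/
structure ProjRep {Γ : Type w} [Group Γ] (α : TwoCocycle K Γ) where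
  space : Vect K
  phi : Γ → (space ≅ space)
  phi_mul (a b : Γ) : (phi b).hom ≫ (phi a).hom = (α.toFun a b : K) • (phi (a * b)).hom

/-- The `2`-character `T(α)` of a `2`-cocycle `α` on `π₀(G)`, as a `2`-character on `G` through the
projection `BG ⟶ Bπ₀(G)`: all lines are `K`, and `ψ` on a `2`-simplex exhibiting `k` as `gh` is
`K ⊗ K ≅ K` followed by multiplication by `α([g],[h])`. For a normalized cocycle the unit isomorphism,
which is multiplication by `α(1,1)`, is the identity. -/
noncomputable def TwoCocycle.toCharacter (α : TwoCocycle K G.PiZero) : TwoCharacter K G where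
  obj _ := Deloop.star (Pic K)
  map _ := 𝟙_ (Pic K)
  mapId _ := scalarIso (α.toFun 1 1) (𝟙_ (Pic K))
  mapComp {_ _ _ e f _} _ := λ_ (𝟙_ (Pic K)) ≪≫
    scalarIso (α.toFun (InftyGroup.cls f) (InftyGroup.cls e)) (𝟙_ (Pic K))
  id_comp {x y} e := by
    have h := scalar_id_comp (C := Pic K) (α.toFun 1 1 : K)
    rw [InftyGroup.cls_id, α.one_right]
    exact h
  comp_id {x y} e := by
    have h := scalar_comp_id (C := Pic K) (α.toFun 1 1 : K)
    rw [InftyGroup.cls_id, α.one_left]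
    exact h
  assoc {_ _ _ _ e₀₁ e₁₂ e₂₃ e₀₂ e₁₃ e₀₃} σ₀ σ₁ σ₂ σ₃ τ _ _ _ _ := by
    have h := congrArg Units.val
      (α.cocycle (InftyGroup.cls e₂₃) (InftyGroup.cls e₁₂) (InftyGroup.cls e₀₁))
    rw [InftyGroup.cls_mul σ₀, InftyGroup.cls_mul σ₃] at h
    exact scalar_assoc (C := Pic K) _ _ _ _ h

theorem ProjRep.phi_one {Γ : Type w} [Group Γ] {α : TwoCocycle K Γ} (P : ProjRep α) :
    (P.phi 1).hom = (α.toFun 1 1 : K) • 𝟙 P.space := by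
  have h := P.phi_mul 1 1
  rw [mul_one] at h
  rw [← cancel_epi (P.phi 1).hom, h]
  simp

/-- The realization of a projective representation of `π₀(G)` with cocycle `α` as a homotopy fixed
point for `T(α)`: `φ_g` is `K ⊗ V ≅ V` followed by the action of the class of `g`. -/
noncomputable def ProjRep.realization {α : TwoCocycle K G.PiZero} (P : ProjRep α) :
    HomotopyFixedPoint α.toCharacter where
  app _ := P.space
  naturality e := λ_ P.space ≪≫ P.phi (InftyGroup.cls e) ≪≫ (ρ_ P.space).symm
  naturality_id x := by
    change (((α.toFun 1 1 : K) • 𝟙 (𝟙_ (Vect K))) ▷ P.space) ≫ (λ_ P.space).hom =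
      ((λ_ P.space).hom ≫ (P.phi (InftyGroup.cls _)).hom ≫ (ρ_ P.space).inv) ≫
        (P.space ◁ 𝟙 (𝟙_ (Vect K))) ≫ (ρ_ P.space).hom
    rw [InftyGroup.cls_id, P.phi_one]
    simp
  naturality_comp {x y z e f g} σ := by
    have h := P.phi_mul (InftyGroup.cls f) (InftyGroup.cls e)
    rw [InftyGroup.cls_mul σ] at h
    change (((λ_ (𝟙_ (Vect K))).hom ≫ ((α.toFun (InftyGroup.cls f) (InftyGroup.cls e) : K) • 𝟙 (𝟙_ (Vect K)))) ▷ P.space) ≫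
      (λ_ P.space).hom ≫ (P.phi (InftyGroup.cls g)).hom ≫ (ρ_ P.space).inv =
      (α_ (𝟙_ (Vect K)) (𝟙_ (Vect K)) P.space).hom ≫
      (𝟙_ (Vect K) ◁ ((λ_ P.space).hom ≫ (P.phi (InftyGroup.cls e)).hom ≫ (ρ_ P.space).inv)) ≫
      (α_ _ _ _).inv ≫ (((λ_ P.space).hom ≫ (P.phi (InftyGroup.cls f)).hom ≫ (ρ_ P.space).inv) ▷ 𝟙_ (Vect K)) ≫
      (α_ _ _ _).hom ≫ (P.space ◁ (ρ_ (𝟙_ (Vect K))).hom)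
    have h' := congrArg (fun t => (α_ (𝟙_ (Vect K)) (𝟙_ (Vect K)) P.space).hom ≫
      (λ_ (𝟙_ (Vect K) ⊗ P.space)).hom ≫ (λ_ P.space).hom ≫ t ≫ (ρ_ P.space).inv) h
    simp only [Linear.smul_comp, Linear.comp_smul, Category.assoc] at h'
    simp [h', MonoidalCategory.unitors_equal]
    rw [← MonoidalCategory.unitors_equal]
    simp

/-- `V`, a homotopy fixed point of `ρ`, is isomorphic to the realization of a projective representation
of `π₀(G)` with `2`-cocycle `α`: there are a projective representation `P` and an isomorphism
`ξ : T(α) ≅ ρ` of `2`-characters on `G`, over which the realization of `P` is isomorphic to `V`. -/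
def IsRealizedBy {ρ : TwoCharacter K G} (V : HomotopyFixedPoint ρ) (α : TwoCocycle K G.PiZero) :
    Prop :=
  ∃ (P : ProjRep α) (ξ : α.toCharacter.Equivalence ρ),
    Nonempty (HomotopyFixedPoint.IsoOver ξ P.realization V)

end Vect
end AnomalousTQFT

/-! Trivializing a line, `e : K ≅ W_g`, turns the structure map `W_g ⊗ V ≅ V` into an automorphism
`V.act e` of `V`. Products of trivializations along a 2-simplex act by composition (`act_mulIso`),
and the inverse unit isomorphism acts as the identity (`act_unit_symm`). Trivializations of one line
differ by a scalar, so `W_g` determines an automorphism of `V` up to scalars. A 2-simplex joining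
two objects in the same class of `π₀(G)` transports trivializations without changing their action
(`exists_act_eq`), so this projective action descends to `π₀(G)`.

For existence, trivializations `ξ_g` are chosen whose actions `φ` depend only on `[g]`. Comparing
`ξ_k` with the product of `ξ_g` and `ξ_h` gives the scalar `α([g],[h])`, and associativity of
composition makes `α` a cocycle. Since `V ≠ 0`, a trivialization is determined by its action
(`hom_eq_smul`), so the relations among the `φ` lift to the compatibilities required of `ξ`.

For uniqueness, two realizations give two families of trivializations; the scalars relating their
actions form the coboundary. -/

namespace AnomalousTQFT
section Realization
open MonoidalCategory

/-! ### Linear algebra of lines and scalars -/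

section Line
variable {K : Type u} [Field K]

/-- An invertible vector space is isomorphic to the ground field. -/
theorem nonempty_unit_iso_of_isInvertible {W : Vect K} (hW : isInvertible K W) :
    Nonempty (𝟙_ (Vect K) ≅ W) := by
  obtain ⟨W', ⟨i⟩⟩ := hW
  have : Module.Invertible K W := Module.Invertible.left (N := W') i.toLinearEquiv
  obtain ⟨e⟩ := (Module.Invertible.free_iff_linearEquiv (R := K) (M := W)).mp inferInstance
  exact ⟨e.symm.toModuleIso⟩

theorem exists_eq_smul_id (f : 𝟙_ (Vect K) ⟶ 𝟙_ (Vect K)) : ∃ c : K, f = c • 𝟙 (𝟙_ (Vect K)) := by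
  refine ⟨f.hom (1 : K), ?_⟩
  ext : 1
  refine LinearMap.ext_ring (R := K) ?_
  change f.hom (1 : K) = f.hom (1 : K) * (1 : K)
  rw [mul_one]

/-- Two trivializations of a line differ by a nonzero scalar. -/
theorem exists_unit_smul {W : Vect K} (e e' : 𝟙_ (Vect K) ≅ W) :
    ∃ c : Kˣ, e'.hom = (c : K) • e.hom := by
  obtain ⟨c, hc⟩ := exists_eq_smul_id (e'.hom ≫ e.inv)
  have h : e'.hom = c • e.hom := by
    rw [← cancel_mono e.inv, hc]
    simp
  refine ⟨Units.mk0 c ?_, h⟩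
  rintro rfl
  rw [zero_smul] at h
  have h1 : 𝟙 (𝟙_ (Vect K)) = 0 := by rw [← e'.hom_inv_id, h, Limits.zero_comp]
  have h2 := congrArg (fun f : 𝟙_ (Vect K) ⟶ 𝟙_ (Vect K) => f.hom (1 : K)) h1
  exact one_ne_zero (α := K) h2

/-- A nonzero vector and a functional with value 1 on it make `K` a retract of `V`, so `g` is
recovered from `g ▷ V` by restricting to that vector and applying the functional. This is where `V ≠
0` makes the action on `V` faithful on the lines. -/
theorem whiskerRight_injective {X Y V : Vect K} [Nontrivial V] {f f' : X ⟶ Y}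
    (h : f ▷ V = f' ▷ V) : f = f' := by
  obtain ⟨v, hv⟩ := exists_ne (0 : V)
  obtain ⟨l, hl⟩ := Module.Projective.exists_dual_eq_one K hv
  let s : 𝟙_ (Vect K) ⟶ V := ModuleCat.ofHom (LinearMap.toSpanSingleton K V v)
  let p : V ⟶ 𝟙_ (Vect K) := ModuleCat.ofHom l
  have hsp : s ≫ p = 𝟙 _ := by
    ext : 1
    refine LinearMap.ext_ring (R := K) ?_
    change l ((1 : K) • v) = (1 : K)
    rw [one_smul, hl]
  have key (g : X ⟶ Y) : (ρ_ X).inv ≫ X ◁ s ≫ g ▷ V ≫ Y ◁ p ≫ (ρ_ Y).hom = g := by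
    rw [← whisker_exchange_assoc, ← MonoidalCategory.whiskerLeft_comp_assoc, hsp]
    simp
  rw [← key f, ← key f', h]

theorem smul_iso_injective {V : Vect K} [Nontrivial V] (e : V ≅ V) {c d : K}
    (h : c • e.hom = d • e.hom) : c = d := by
  have h1 : c • 𝟙 V = d • 𝟙 V := by
    rw [← e.hom_inv_id, ← Linear.smul_comp, h, Linear.smul_comp]
  obtain ⟨v, hv⟩ := exists_ne (0 : V)
  have h2 := congrArg (fun f : V ⟶ V => f.hom v) h1
  exact smul_left_injective K hv h2

end Line

/-- Filling the inner horn with edges `h` and `g` gives a product of objects. -/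
theorem InftyGroup.exists_compStruct {G : InftyGroup.{w}} (h g : G.Obj) :
    ∃ k : G.Obj, Nonempty (SSet.Edge.CompStruct h g k) := by
  obtain ⟨t, ht⟩ := exists_filler (X := G.B) (n := 0) 1 ![g.edge, g.edge, h.edge] (by
    intro j k hj hk hjk
    fin_cases j <;> fin_cases k <;> simp at hj hk hjk
    exact g.src_eq.trans h.tgt_eq.symm)
  exact ⟨SSet.Edge.mk (G.B.δ 1 t) (Subsingleton.elim _ _) (Subsingleton.elim _ _),
    ⟨SSet.Edge.CompStruct.mk t (ht 2 (by decide)) (ht 0 (by decide)) rfl⟩⟩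

variable {K : Type u} [Field K] {G : InftyGroup.{w}} {ρ : TwoCharacter K G}

theorem TwoCharacter.nonempty_unit_iso_line (ρ : TwoCharacter K G) (g : G.Obj) :
    Nonempty (𝟙_ (Vect K) ≅ ρ.line g) :=
  nonempty_unit_iso_of_isInvertible (ρ.map g).property

/-- The product of trivializations of `W_g` and `W_h`, as a trivialization of `W_k`. -/
def TwoCharacter.mulIso (ρ : TwoCharacter K G) {g h k : G.Obj} (σ : SSet.Edge.CompStruct h g k)
    (e : 𝟙_ (Vect K) ≅ ρ.line g) (e' : 𝟙_ (Vect K) ≅ ρ.line h) : 𝟙_ (Vect K) ≅ ρ.line k :=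
  (λ_ (𝟙_ (Vect K))).symm ≪≫ (e ⊗ᵢ e') ≪≫ ρ.psi σ

/-! ### Automorphisms of the fixed point given by trivialized lines -/

namespace HomotopyFixedPoint
variable (V : HomotopyFixedPoint ρ)

/-- The isomorphisms `W_g ⊗ V ≅ V ⊗ K` of a homotopy fixed point, as a morphism of `∞`-functors. -/
def nat (g : G.Obj) : ρ.line g ⊗ V.space ≅ V.space ⊗ 𝟙_ (Vect K) := V.naturality g

theorem phi_hom (g : G.Obj) : (V.phi g).hom = (V.nat g).hom ≫ (ρ_ V.space).hom := rfl

theorem phi_psi {g h k : G.Obj} (σ : SSet.Edge.CompStruct h g k) :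
    (ρ.psi σ).hom ▷ V.space ≫ (V.phi k).hom =
      (α_ (ρ.line g) (ρ.line h) V.space).hom ≫ ρ.line g ◁ (V.phi h).hom ≫ (V.phi g).hom := by
  have key : (ρ.psi σ).hom ▷ V.space ≫ (V.nat k).hom =
      (α_ (ρ.line g) (ρ.line h) V.space).hom ≫ ρ.line g ◁ (V.nat h).hom ≫
      (α_ (ρ.line g) V.space (𝟙_ (Vect K))).inv ≫ (V.nat g).hom ▷ 𝟙_ (Vect K) ≫
      (α_ V.space (𝟙_ (Vect K)) (𝟙_ (Vect K))).hom ≫ V.space ◁ (ρ_ (𝟙_ (Vect K))).hom :=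
    V.naturality_comp σ
  rw [phi_hom, phi_hom, phi_hom, reassoc_of% key]
  simp

theorem phi_id :
    (V.phi (SSet.Edge.id G.pt)).hom = ρ.unit.hom ▷ V.space ≫ (λ_ V.space).hom := by
  have key : ρ.unit.hom ▷ V.space ≫ (λ_ V.space).hom =
      (V.nat (SSet.Edge.id G.pt)).hom ≫ V.space ◁ 𝟙 (𝟙_ (Vect K)) ≫ (ρ_ V.space).hom :=
    V.naturality_id G.pt
  rw [key, phi_hom]
  simp

/-- The automorphism of `V` given by a trivialization of `W_g`. -/
def act {g : G.Obj} (e : 𝟙_ (Vect K) ≅ ρ.line g) : V.space ≅ V.space :=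
  (λ_ V.space).symm ≪≫ whiskerRightIso e V.space ≪≫ V.phi g

theorem act_hom {g : G.Obj} (e : 𝟙_ (Vect K) ≅ ρ.line g) :
    (V.act e).hom = (λ_ V.space).inv ≫ e.hom ▷ V.space ≫ (V.phi g).hom := rfl

theorem act_mulIso {g h k : G.Obj} (σ : SSet.Edge.CompStruct h g k)
    (e : 𝟙_ (Vect K) ≅ ρ.line g) (e' : 𝟙_ (Vect K) ≅ ρ.line h) :
    (V.act (ρ.mulIso σ e e')).hom = (V.act e').hom ≫ (V.act e).hom := by
  have h1 : (V.act (ρ.mulIso σ e e')).hom =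
      (λ_ V.space).inv ≫ e.hom ▷ V.space ≫ ρ.line g ◁ (V.act e').hom ≫ (V.phi g).hom := by
    simp [act_hom, TwoCharacter.mulIso, phi_psi, MonoidalCategory.tensorHom_def]
  rw [h1, ← whisker_exchange_assoc, ← leftUnitor_inv_naturality_assoc, V.act_hom e]

theorem act_unit_symm : (V.act ρ.unit.symm).hom = 𝟙 V.space := by
  simp [act_hom, phi_id]

theorem act_smul {g : G.Obj} {e e' : 𝟙_ (Vect K) ≅ ρ.line g} {c : K} (h : e'.hom = c • e.hom) :
    (V.act e').hom = c • (V.act e).hom := by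
  simp [act_hom, h]

theorem hom_eq_smul [Nontrivial V.space] {g : G.Obj} {e e' : 𝟙_ (Vect K) ≅ ρ.line g} {c : K}
    (h : (V.act e').hom = c • (V.act e).hom) : e'.hom = c • e.hom := by
  apply whiskerRight_injective (V := V.space)
  rw [← cancel_epi (λ_ V.space).inv, ← cancel_mono (V.phi g).hom]
  simpa [act_hom] using h

/-- A homotopy from `g` to `h` exhibits `h` as `1 · g`; multiplying `e` by the inverse unit
isomorphism, which acts trivially, trivializes `W_h`. -/
theorem exists_act_eq {g h : G.Obj} (H : InftyGroup.cls g = InftyGroup.cls h)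
    (e : 𝟙_ (Vect K) ≅ ρ.line g) : ∃ e' : 𝟙_ (Vect K) ≅ ρ.line h, (V.act e').hom = (V.act e).hom := by
  obtain ⟨σ⟩ := (InftyGroup.cls_eq_iff g h).mp H
  refine ⟨ρ.mulIso σ ρ.unit.symm e, ?_⟩
  rw [act_mulIso, act_unit_symm, Category.comp_id]

/-- Trivializations of all lines for which the action on `V` depends only on classes in `π₀(G)`. -/
theorem exists_trivialization :
    ∃ (φ : G.PiZero → (V.space ≅ V.space)) (ξ : ∀ g : G.Obj, 𝟙_ (Vect K) ≅ ρ.line g),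
      ∀ g, (V.act (ξ g)).hom = (φ (InftyGroup.cls g)).hom := by
  -- Fix one object per class with an arbitrary trivialization, then transport it to every other
  -- object of that class.
  choose r hr using InftyGroup.cls_surjective (G := G)
  choose ξ hξ using fun g : G.Obj => V.exists_act_eq (hr (InftyGroup.cls g))
    (ρ.nonempty_unit_iso_line (r (InftyGroup.cls g))).some
  exact ⟨fun a => V.act (ρ.nonempty_unit_iso_line (r a)).some, ξ, hξ⟩

theorem exists_cocycle_value {φ : G.PiZero → (V.space ≅ V.space)}
    {ξ : ∀ g : G.Obj, 𝟙_ (Vect K) ≅ ρ.line g}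
    (hξ : ∀ g, (V.act (ξ g)).hom = (φ (InftyGroup.cls g)).hom) (a b : G.PiZero) :
    ∃ c : Kˣ, (φ b).hom ≫ (φ a).hom = (c : K) • (φ (a * b)).hom := by
  obtain ⟨g, rfl⟩ := InftyGroup.cls_surjective a
  obtain ⟨h, rfl⟩ := InftyGroup.cls_surjective b
  obtain ⟨k, ⟨σ⟩⟩ := InftyGroup.exists_compStruct h g
  obtain ⟨c, hc⟩ := exists_unit_smul (ξ k) (ρ.mulIso σ (ξ g) (ξ h))
  refine ⟨c, ?_⟩
  rw [InftyGroup.cls_mul σ, ← hξ, ← hξ, ← hξ, ← V.act_mulIso σ, V.act_smul hc]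

end HomotopyFixedPoint

/-! ### Existence of the cocycle and the realization -/

/-- The scalars by which a projective action on a nonzero vector space fails to be multiplicative
form a `2`-cocycle. -/
def TwoCocycle.ofProjective {Γ : Type w} [Group Γ] {U : Vect K} [Nontrivial U] (φ : Γ → (U ≅ U))
    (α : Γ → Γ → Kˣ) (h : ∀ a b, (φ b).hom ≫ (φ a).hom = (α a b : K) • (φ (a * b)).hom) :
    TwoCocycle K Γ where
  toFun := α
  cocycle a b c := by
    -- Both bracketings are multiples of the automorphism `φ (a * (b * c))`; as `U ≠ 0`, the
    -- coefficients agree.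
    have h1 : (φ c).hom ≫ ((φ b).hom ≫ (φ a).hom) = ((φ c).hom ≫ (φ b).hom) ≫ (φ a).hom := by simp
    rw [h, h, Linear.comp_smul, Linear.smul_comp, h, h, smul_smul, smul_smul, mul_assoc a b c] at h1
    ext
    push_cast
    rw [mul_comm (α a (b * c) : K), mul_comm (α (a * b) c : K)]
    exact smul_iso_injective _ h1

theorem ProjRep.realization_phi {α : TwoCocycle K G.PiZero} (P : ProjRep α) (g : G.Obj) :
    (P.realization.phi g).hom = (λ_ P.space).hom ≫ (P.phi (InftyGroup.cls g)).hom := by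
  change ((λ_ P.space).hom ≫ (P.phi (InftyGroup.cls g)).hom ≫ (ρ_ P.space).inv) ≫
    (ρ_ P.space).hom = _
  simp

theorem HomotopyFixedPoint.exists_isRealizedBy (V : HomotopyFixedPoint ρ) [Nontrivial V.space] :
    ∃ α : TwoCocycle K G.PiZero, IsRealizedBy V α := by
  obtain ⟨φ, ξ, hξ⟩ := V.exists_trivialization
  choose c hc using V.exists_cocycle_value hξ
  let α : TwoCocycle K G.PiZero := .ofProjective φ c hc
  let P : ProjRep α := ⟨V.space, φ, hc⟩
  refine ⟨α, P, ⟨ξ, ?_, fun {g h k} σ => ?_⟩, ⟨⟨Iso.refl _, fun g => ?_⟩⟩⟩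
  -- The cocycle need not be normalized: `φ 1` is multiplication by `α(1,1)`, matching the unit
  -- isomorphism of `T(α)`.
  · have h1 : (V.act (ξ (SSet.Edge.id G.pt))).hom = (α.toFun 1 1 : K) • (V.act ρ.unit.symm).hom := by
      rw [hξ, V.act_unit_symm, InftyGroup.cls_id]
      exact P.phi_one
    have h2 := V.hom_eq_smul h1
    have h3 : (ξ (SSet.Edge.id G.pt)).hom ≫ ρ.unit.hom =
        (α.toFun 1 1 : K) • 𝟙 (𝟙_ (Vect K)) := by
      rw [h2, Linear.smul_comp]
      simp
    exact h3
  · have h1 : (V.act (ρ.mulIso σ (ξ g) (ξ h))).hom =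
        (α.toFun (InftyGroup.cls g) (InftyGroup.cls h) : K) • (V.act (ξ k)).hom := by
      rw [V.act_mulIso, hξ, hξ, hξ, ← InftyGroup.cls_mul σ]
      exact hc _ _
    have h2 := V.hom_eq_smul h1
    have h3 : ((ξ g).hom ⊗ₘ (ξ h).hom) ≫ (ρ.psi σ).hom =
        (λ_ (𝟙_ (Vect K))).hom ≫ (ρ.mulIso σ (ξ g) (ξ h)).hom := by
      simp [TwoCharacter.mulIso]
    have h4 : (λ_ (𝟙_ (Vect K))).hom ≫ (ρ.mulIso σ (ξ g) (ξ h)).hom = ((λ_ (𝟙_ (Vect K))).hom ≫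
        ((α.toFun (InftyGroup.cls g) (InftyGroup.cls h) : K) • 𝟙 (𝟙_ (Vect K)))) ≫ (ξ k).hom := by
      rw [h2, Linear.comp_smul, Linear.comp_smul, Linear.smul_comp, Category.comp_id]
    exact h3.trans h4
  · rw [ProjRep.realization_phi]
    have h1 := hξ g
    rw [HomotopyFixedPoint.act_hom] at h1
    change ((ξ g).hom ⊗ₘ 𝟙 V.space) ≫ (V.phi g).hom =
      ((λ_ V.space).hom ≫ (φ (InftyGroup.cls g)).hom) ≫ 𝟙 V.space
    rw [← h1]
    simp

/-! ### Uniqueness of the cocycle up to coboundaries -/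

/-- A realization of `V` gives trivializations of all lines that act on `V` by the automorphisms of
the projective representation. -/
theorem IsRealizedBy.exists_trivialization {V : HomotopyFixedPoint ρ} {α : TwoCocycle K G.PiZero}
    (h : IsRealizedBy V α) :
    ∃ φ : G.PiZero → (V.space ≅ V.space),
      (∀ a b, (φ b).hom ≫ (φ a).hom = (α.toFun a b : K) • (φ (a * b)).hom) ∧
      ∀ g, ∃ e : 𝟙_ (Vect K) ≅ ρ.line g, (V.act e).hom = (φ (InftyGroup.cls g)).hom := by
  obtain ⟨P, ξ, ⟨f⟩⟩ := h
  let i : P.space ≅ V.space := f.iso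
  -- Conjugating by `P.space ≅ V.space` puts all realizations on the same space `V`, where they can
  -- be compared.
  refine ⟨fun a => i.symm ≪≫ P.phi a ≪≫ i, fun a b => ?_, fun g => ⟨ξ.xi g, ?_⟩⟩
  · have := P.phi_mul a b
    simp only [Iso.trans_hom, Iso.symm_hom, Category.assoc, Iso.hom_inv_id_assoc]
    rw [reassoc_of% this]
    simp
  · have h1 := f.comm g
    rw [ProjRep.realization_phi] at h1
    let x : 𝟙_ (Vect K) ≅ ρ.line g := ξ.xi g
    have h2 : (x.hom ⊗ₘ i.hom) ≫ (V.phi g).hom =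
      ((λ_ P.space).hom ≫ (P.phi (InftyGroup.cls g)).hom) ≫ i.hom := h1
    change (λ_ V.space).inv ≫ x.hom ▷ V.space ≫ (V.phi g).hom =
      i.inv ≫ (P.phi (InftyGroup.cls g)).hom ≫ i.hom
    rw [← cancel_epi i.hom, ← cancel_epi (λ_ P.space).hom]
    simp only [Category.assoc, Iso.hom_inv_id_assoc] at h2 ⊢
    rw [← h2, MonoidalCategory.tensorHom_def']
    simp

theorem IsRealizedBy.equivalent {V : HomotopyFixedPoint ρ} [Nontrivial V.space]
    {α α' : TwoCocycle K G.PiZero} (h : IsRealizedBy V α) (h' : IsRealizedBy V α') :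
    α.Equivalent α' := by
  obtain ⟨φ, hφ, hξ⟩ := h.exists_trivialization
  obtain ⟨φ', hφ', hξ'⟩ := h'.exists_trivialization
  have hβ : ∀ a, ∃ c : Kˣ, (φ' a).hom = (c : K) • (φ a).hom := by
    intro a
    obtain ⟨g, rfl⟩ := InftyGroup.cls_surjective a
    obtain ⟨e, he⟩ := hξ g
    obtain ⟨e', he'⟩ := hξ' g
    obtain ⟨c, hc⟩ := exists_unit_smul e e'
    exact ⟨c, by rw [← he, ← he', V.act_smul hc]⟩
  choose β hβ using hβ
  refine ⟨β, fun a b => ?_⟩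
  have h1 := hφ' a b
  -- With `φ' = β φ`, the relation for `φ'` equates two multiples of `φ (a * b)`; their coefficients
  -- give the coboundary identity.
  rw [hβ, hβ, hβ, Linear.comp_smul, Linear.smul_comp, hφ, smul_smul, smul_smul, smul_smul] at h1
  ext
  push_cast
  rw [← smul_iso_injective _ h1]
  ring

end Realization
end AnomalousTQFT

theorem proposition5p10 {K : Type u} [Field K] (G : AnomalousTQFT.InftyGroup.{w})
    (ρ : AnomalousTQFT.TwoCharacter K G) (V : AnomalousTQFT.HomotopyFixedPoint ρ)
    (hV : Nontrivial V.space) :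
    (∃ α : AnomalousTQFT.TwoCocycle K G.PiZero, AnomalousTQFT.IsRealizedBy V α) ∧
      ∀ α α' : AnomalousTQFT.TwoCocycle K G.PiZero,
        AnomalousTQFT.IsRealizedBy V α → AnomalousTQFT.IsRealizedBy V α' → α.Equivalent α' := by
  exact ⟨V.exists_isRealizedBy, fun _ _ h h' => h.equivalent h'⟩
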